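/- Let $p$ be a prime and let $G$ be a group of order $p^7$ whose nilpotency class $cl(G)$ is not $2$. Let $Z(G)$ be the center of $G$, $Z_2(G)$ the second center (so that $Z_2(G)/Z(G)=Z(G/Z(G))$), $G'$ the derived subgroup, and for a finite group $H$ let $d(H)$ be the minimal number of generators of $H$; $C_m$ denotes the cyclic group of order $m$. Let $\mathrm{Aut}_z(G)$ be the group of central automorphisms of $G$, i.e. the automorphisms $\alpha$ with $x^{-1}\alpha(x)\in Z(G)$ for all $x\in G$, and let $Z(\mathrm{Inn}(G))$ be the center of the group of inner automorphisms of $G$. Then $\mathrm{Aut}_z(G)=Z(\mathrm{Inn}(G))$ (as subgroups of $\mathrm{Aut}(G)$) if and only if one of the following holds: (i) $cl(G)=3$, $Z(G)\simeq C_p$ and $d(G)=d(Z_2(G)/Z(G))\in\{2,3,4\}$; (ii) $cl(G)=4$, and either $Z(G)\simeq C_p$ and $d(G)=d(Z_2(G)/Z(G))\in\{2,3\}$, or $Z(G)\simeq C_{p^2}$ and $Z_2(G)/Z(G)\simeq G/G'$; (iii) $cl(G)=5$, $Z(G)\simeq C_p$ and $d(G)=d(Z_2(G)/Z(G))=2$.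 -/

import Mathlib

/-- The group `Aut_z(G)` of central automorphisms of `G`: the automorphisms `α` such that
`x⁻¹ * α x` lies in the center of `G` for every `x`. -/
def centralAut (G : Type*) [Group G] : Subgroup (MulAut G) where
  carrier := {α | ∀ x : G, x⁻¹ * α x ∈ Subgroup.center G}
  one_mem' := fun x => by simp
  mul_mem' := by
    intro α β hα hβ x
    have h := mul_mem (hβ x) (hα (β x))
    simpa [mul_assoc] using h
  inv_mem' := by
    intro α hα x
    have h := inv_mem (hα (α⁻¹ x))
    simpa using h

/-- The group `Inn(G)` of inner automorphisms of `G`. -/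
abbrev innerAut (G : Type*) [Group G] : Subgroup (MulAut G) :=
  (MulAut.conj : G →* MulAut G).range

/-- The center `Z(Inn(G))` of the group of inner automorphisms, as a subgroup of `Aut(G)`. -/
def centerInn (G : Type*) [Group G] : Subgroup (MulAut G) :=
  (Subgroup.center (innerAut G)).map (innerAut G).subtype

/-- The second center `Z_2(G)`. -/
abbrev secondCenter (G : Type*) [Group G] : Subgroup G :=
  Subgroup.upperCentralSeries G 2

/-- The quotient `Z_2(G)/Z(G)`. -/
abbrev SecondCenterQuot (G : Type*) [Group G] : Type _ :=
  secondCenter G ⧸ (Subgroup.center G).subgroupOf (secondCenter G)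

/-! For `g` in `Z₂`, the map `x ↦ x⁻¹ g x g⁻¹` is a homomorphism from `G` to `Z`, and it is trivial
exactly when `g` is central. So `Z₂/Z` embeds in `Hom(G, Z)` (`secondCenterQuotHom`). If `Z`
consists of nongenerators, every `f` in `Hom(G, Z)` yields a central automorphism `x ↦ x f(x)`, and
the equality of the two groups says that this embedding is onto
(`centralAut_eq_centerInn_iff_surjective`). For nonabelian `G` the equality itself forces `Z` to
consist of nongenerators, and so does `Z ≤ G'`, which holds in every listed case.

What remains is counting. Put `|Z| = p^k`, `|Z₂/Z| = p^m` and let `c ≥ 3` be the class; then `k + m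
+ c ≤ 8` (`IsPGroup.add_le_of_card_center_eq`). Since `|Hom(G, C_p)| = p^d(G)`, surjectivity gives
`m ≥ d(G) ≥ 2`, and `m ≥ 2 d(G)` for noncyclic `Z`, which is too large; so `Z` is cyclic. For `k =
1` everything is elementary abelian and the condition is equality of ranks. For `k ≥ 2`, class at
least 5 leaves no room and class 4 forces `k = m = 2`, where `Hom(G, Z)` is isomorphic to `G/G'`.
The delicate point is that class 3 is impossible there
(`IsPGroup.card_center_eq_prime_of_commutator_le_secondCenter`). -/

/-! ### Homomorphisms to a group of order `p` and the number of generators -/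

theorem Subgroup.exists_normal_index_eq_prime {p : ℕ} [Fact p.Prime] {G : Type*} [Group G] [Finite G]
    (hG : IsPGroup p G) {H : Subgroup G} (hH : H ≠ ⊤) :
    ∃ K : Subgroup G, H ≤ K ∧ K.Normal ∧ K.index = p := by
  have hp : p.Prime := Fact.out
  obtain ⟨n, hn⟩ := IsPGroup.iff_card.mp hG
  obtain ⟨m, hm⟩ := IsPGroup.iff_card.mp (hG.to_subgroup H)
  have hmn : m < n := by
    have h1 : Nat.card H < Nat.card G := by
      refine lt_of_le_of_ne (Subgroup.card_le_card_group H) fun h => hH (Subgroup.eq_top_of_card_eq H h)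
    rw [hm, hn] at h1
    exact (Nat.pow_lt_pow_iff_right hp.one_lt).mp h1
  obtain ⟨n, rfl⟩ : ∃ k, n = k + 1 := ⟨n - 1, by omega⟩
  obtain ⟨K, hK, hHK⟩ := Sylow.exists_subgroup_card_pow_prime_le (G := G) p (n := m) (m := n)
    (by rw [hn]; exact pow_dvd_pow p (by omega)) H hm (by omega)
  have hidx : K.index = p := by
    have := K.card_mul_index
    rw [hK, hn, pow_succ] at this
    exact Nat.eq_of_mul_eq_mul_left (pow_pos hp.pos n) this
  refine ⟨K, hHK, Subgroup.normal_of_index_eq_minFac_card ?_, hidx⟩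
  rw [hidx, hn, Nat.Prime.pow_minFac hp (by omega)]

theorem IsPGroup.exists_monoidHom_ne_one {p : ℕ} [Fact p.Prime] {G : Type*} [Group G] [Finite G]
    (hG : IsPGroup p G) {C : Type*} [CommGroup C] (hC : Nat.card C = p)
    {H : Subgroup G} (hH : H ≠ ⊤) :
    ∃ f : G →* C, f ≠ 1 ∧ ∀ x ∈ H, f x = 1 := by
  obtain ⟨K, hHK, hK, hidx⟩ := Subgroup.exists_normal_index_eq_prime hG hH
  let e : G ⧸ K ≃* C := mulEquivOfPrimeCardEq (p := p) hidx hC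
  refine ⟨e.toMonoidHom.comp (QuotientGroup.mk' K), fun h => ?_, fun x hx => ?_⟩
  · have hKt : K = ⊤ := by
      refine eq_top_iff.mpr fun x _ => ?_
      have h1 := DFunLike.congr_fun h x
      simp only [MonoidHom.comp_apply, MonoidHom.one_apply] at h1
      exact (QuotientGroup.eq_one_iff x).mp (e.injective (by simpa using h1))
    rw [hKt, Subgroup.index_top] at hidx
    exact (Fact.out : p.Prime).one_lt.ne hidx
  · simpa using hHK hx

theorem MonoidHom.finite_of_finite {G C : Type*} [Group G] [Group C] [Finite G] [Finite C] :
    Finite (G →* C) := DFunLike.finite _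

attribute [instance] MonoidHom.finite_of_finite

/-- The homomorphisms from `G` to `C` which are trivial on `H`. -/
def Subgroup.annihilator {G : Type*} [Group G] (H : Subgroup G) (C : Type*) [CommGroup C] :
    Subgroup (G →* C) where
  carrier := {f | ∀ x ∈ H, f x = 1}
  one_mem' := fun _ _ => rfl
  mul_mem' := fun {f g} hf hg x hx => by simp [hf x hx, hg x hx]
  inv_mem' := fun {f} hf x hx => by simp [hf x hx]

/-- Adjoining to `H` an element not killed by some `f` in its annihilator shrinks the annihilator by
a factor of at least `p`, so a generating set is reached before the annihilator is used up. -/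
theorem IsPGroup.exists_finset_sup_closure_eq_top {p : ℕ} [Fact p.Prime] {G : Type*} [Group G]
    [Finite G] (hG : IsPGroup p G) {C : Type*} [CommGroup C] (hC : Nat.card C = p) (n : ℕ) :
    ∀ H : Subgroup G, Nat.card (H.annihilator C) ≤ n →
      ∃ S : Finset G, H ⊔ Subgroup.closure (S : Set G) = ⊤ ∧ p ^ S.card ≤ Nat.card (H.annihilator C) := by
  classical
  have hp : p.Prime := Fact.out
  have : Finite C := Nat.finite_of_card_ne_zero (by rw [hC]; exact hp.ne_zero)
  have hGC : IsPGroup p (G →* C) := fun f => ⟨1, by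
    ext x
    simpa [hC] using pow_card_eq_one' (x := f x)⟩
  induction n with
  | zero => intro H h; exact absurd (Nat.card_pos (α := H.annihilator C)) (by omega)
  | succ n ih =>
    intro H hn
    by_cases hH : H = ⊤
    · refine ⟨∅, by simp [hH], ?_⟩
      rw [Finset.card_empty, pow_zero]
      exact Nat.card_pos
    obtain ⟨f, hf1, hf⟩ := hG.exists_monoidHom_ne_one hC hH
    obtain ⟨g, hg⟩ : ∃ g, f g ≠ 1 := by
      by_contra! h
      exact hf1 (MonoidHom.ext h)
    set K := H ⊔ Subgroup.closure {g} with hK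
    have hle : K.annihilator C ≤ H.annihilator C := fun φ hφ x hx => hφ x (le_sup_left (a := H) hx)
    have hlt : Nat.card (K.annihilator C) * p ≤ Nat.card (H.annihilator C) := by
      obtain ⟨a, ha⟩ := IsPGroup.iff_card.mp (hGC.to_subgroup (K.annihilator C))
      obtain ⟨b, hb⟩ := IsPGroup.iff_card.mp (hGC.to_subgroup (H.annihilator C))
      have hne : K.annihilator C ≠ H.annihilator C := fun h => hg
        ((h ▸ hf : f ∈ K.annihilator C) g
          (le_sup_right (a := H) (Subgroup.subset_closure rfl)))
      have h1 : Nat.card (K.annihilator C) ≠ Nat.card (H.annihilator C) := fun h =>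
        hne (Subgroup.eq_of_le_of_card_ge hle h.ge)
      have h2 := Nat.le_of_dvd Nat.card_pos (Subgroup.card_dvd_of_le hle)
      rw [ha, hb] at *
      rw [← pow_succ]
      refine Nat.pow_le_pow_right hp.pos ?_
      exact (Nat.pow_lt_pow_iff_right hp.one_lt).mp (lt_of_le_of_ne h2 h1)
    have h2 := hp.two_le
    have h3 : 0 < Nat.card (K.annihilator C) := Nat.card_pos
    obtain ⟨S, hS, hSc⟩ := ih K (by nlinarith)
    refine ⟨insert g S, ?_, ?_⟩
    · rw [eq_top_iff, ← hS, hK, Finset.coe_insert, Set.insert_eq, Subgroup.closure_union, sup_assoc]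
    · calc p ^ (insert g S).card ≤ p ^ (S.card + 1) :=
            Nat.pow_le_pow_right hp.pos (Finset.card_insert_le _ _)
        _ ≤ Nat.card (K.annihilator C) * p := by rw [pow_succ]; gcongr
        _ ≤ _ := hlt

theorem IsPGroup.pow_rank_eq_card_monoidHom {p : ℕ} [Fact p.Prime] {G : Type*} [Group G]
    [Finite G] (hG : IsPGroup p G) {C : Type*} [CommGroup C] (hC : Nat.card C = p) :
    p ^ Group.rank G = Nat.card (G →* C) := by
  have hp : p.Prime := Fact.out
  have : Finite C := Nat.finite_of_card_ne_zero (by rw [hC]; exact hp.ne_zero)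
  apply le_antisymm
  · obtain ⟨S, hS, hc⟩ := hG.exists_finset_sup_closure_eq_top hC _ ⊥ le_rfl
    rw [bot_sup_eq] at hS
    calc p ^ Group.rank G ≤ p ^ S.card := Nat.pow_le_pow_right hp.pos (Group.rank_le hS)
      _ ≤ _ := hc
      _ ≤ _ := Subgroup.card_le_card_group _
  · obtain ⟨S, hS, hSt⟩ := Group.rank_spec G
    have hinj : Function.Injective (fun (f : G →* C) (s : S) => f s) := fun f g h =>
      MonoidHom.eq_of_eqOn_dense hSt (fun s hs => congr_fun h ⟨s, hs⟩)
    calc Nat.card (G →* C) ≤ Nat.card (S → C) := Nat.card_le_card_of_injective _ hinj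
      _ = p ^ Group.rank G := by simp [Nat.card_fun, hC, hS]

/-! ### Homomorphisms to cyclic groups -/

theorem Group.isCyclic_of_rank_le_one {G : Type*} [Group G] [Group.FG G] (h : Group.rank G ≤ 1) :
    IsCyclic G := by
  obtain ⟨S, hS, hSt⟩ := Group.rank_spec G
  rw [← hS, Finset.card_le_one_iff_subset_singleton] at h
  obtain ⟨x, hx⟩ := h
  refine ⟨x, fun y => ?_⟩
  have : y ∈ Subgroup.closure (S : Set G) := hSt ▸ Subgroup.mem_top y
  have h2 : y ∈ Subgroup.zpowers x := by
    rw [Subgroup.zpowers_eq_closure]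
    exact Subgroup.closure_mono (fun z hz => Finset.mem_singleton.mp (hx hz)) this
  exact Subgroup.mem_zpowers_iff.mp h2

/-- A generator of `C` is a primitive root of unity in the monoid `C`. This makes duality of finite
abelian groups available with values in `C`. -/
theorem IsCyclic.hasEnoughRootsOfUnity {C : Type*} [CommGroup C] [Finite C] [IsCyclic C] {n : ℕ}
    (hn : n ∣ Nat.card C) : HasEnoughRootsOfUnity C n := by
  have : NeZero (Nat.card C) := ⟨Nat.card_pos.ne'⟩
  have : HasEnoughRootsOfUnity C (Nat.card C) := by
    have : IsCyclic Cˣ := isCyclic_of_surjective (toUnits : C ≃* Cˣ) toUnits.surjective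
    refine ⟨?_, inferInstance⟩
    obtain ⟨g, hg⟩ := IsCyclic.exists_generator (α := C)
    exact ⟨g, orderOf_eq_card_of_forall_mem_zpowers hg ▸ IsPrimitiveRoot.orderOf g⟩
  exact HasEnoughRootsOfUnity.of_dvd C hn

theorem CommGroup.nonempty_monoidHom_mulEquiv {A C : Type*} [CommGroup A] [Finite A] [CommGroup C]
    [Finite C] [IsCyclic C] (h : Monoid.exponent A ∣ Nat.card C) : Nonempty ((A →* C) ≃* A) := by
  have := IsCyclic.hasEnoughRootsOfUnity h
  obtain ⟨e⟩ := CommGroup.monoidHom_mulEquiv_of_hasEnoughRootsOfUnity A C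
  exact ⟨(MulEquiv.monoidHomCongrRight (toUnits : C ≃* Cˣ)).trans e⟩

theorem CommGroup.exists_apply_ne_one_of_isCyclic {A C : Type*} [CommGroup A] [Finite A]
    [CommGroup C] [Finite C] [IsCyclic C] (h : Monoid.exponent A ∣ Nat.card C) {a : A}
    (ha : a ≠ 1) : ∃ f : A →* C, f a ≠ 1 := by
  have := IsCyclic.hasEnoughRootsOfUnity h
  obtain ⟨f, hf⟩ := CommGroup.exists_apply_ne_one_of_hasEnoughRootsOfUnity A C ha
  refine ⟨(toUnits : C ≃* Cˣ).symm.toMonoidHom.comp f, fun h => hf ?_⟩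
  exact (toUnits : C ≃* Cˣ).symm.injective (by simpa using h)

/-- Homomorphisms to `C` separate the points of `A/A^(p^k)`, so the hypothesis puts `A^p` inside
`A^(p^k)`. As `k ≥ 2`, iteration pushes `A^p` into arbitrarily high powers, which vanish. -/
theorem IsPGroup.pow_prime_eq_one_of_monoidHom {p k : ℕ} [Fact p.Prime] {A C : Type*} [CommGroup A]
    [Finite A] [CommGroup C] [IsCyclic C] (hA : IsPGroup p A) (hC : Nat.card C = p ^ k)
    (hk : 2 ≤ k) (h : ∀ f : A →* C, f ^ p = 1) (a : A) : a ^ p = 1 := by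
  have hp : p.Prime := Fact.out
  have : Finite C := Nat.finite_of_card_ne_zero (by rw [hC]; exact pow_ne_zero _ hp.ne_zero)
  let P : Subgroup A := (powMonoidHom (p ^ k) : A →* A).range
  have key : ∀ a : A, ∃ b : A, a ^ p = b ^ p ^ k := by
    intro a
    by_contra! hab
    have hQ : Monoid.exponent (A ⧸ P) ∣ Nat.card C := by
      rw [hC]
      refine Monoid.exponent_dvd_of_forall_pow_eq_one fun x => ?_
      induction x using QuotientGroup.induction_on with
      | H x =>
        rw [← QuotientGroup.mk_pow, QuotientGroup.eq_one_iff]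
        exact ⟨x, rfl⟩
    have hne : ((a ^ p : A) : A ⧸ P) ≠ 1 := by
      rw [ne_eq, QuotientGroup.eq_one_iff]
      rintro ⟨b, hb⟩
      exact hab b hb.symm
    obtain ⟨f, hf⟩ := CommGroup.exists_apply_ne_one_of_isCyclic hQ hne
    apply hf
    have := DFunLike.congr_fun (h (f.comp (QuotientGroup.mk' P))) a
    simpa using this
  have iter : ∀ (n : ℕ) (a : A), ∃ b : A, a ^ p = b ^ p ^ (n + 1) := by
    intro n
    induction n with
    | zero => intro a; exact ⟨a, by simp⟩
    | succ n ih =>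
      intro a
      obtain ⟨b, hb⟩ := key a
      -- Here `a ^ p` is the `p`-th power of `(b ^ p ^ (k - 2)) ^ p`, to which the induction
      -- hypothesis applies.
      obtain ⟨c, hc⟩ := ih (b ^ p ^ (k - 2))
      refine ⟨c, ?_⟩
      obtain ⟨k, rfl⟩ : ∃ j, k = j + 2 := ⟨k - 2, by omega⟩
      rw [Nat.add_sub_cancel] at hc
      rw [hb, pow_add, pow_mul, sq, pow_mul, hc, ← pow_mul, ← pow_succ]
  obtain ⟨n, hn⟩ := IsPGroup.iff_card.mp hA
  obtain ⟨b, hb⟩ := iter n a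
  rw [hb, pow_succ, pow_mul, ← hn, pow_card_eq_one', one_pow]

/-! ### Noncyclic abelian targets -/

theorem IsPGroup.isCyclic_of_card_ker_pow_le {p : ℕ} [Fact p.Prime] {Z : Type*} [CommGroup Z]
    [Finite Z] (hZ : IsPGroup p Z) (h : Nat.card (powMonoidHom p : Z →* Z).ker ≤ p) :
    IsCyclic Z := by
  classical
  have hp : p.Prime := Fact.out
  have key : ∀ n, Nat.card (powMonoidHom (p ^ n) : Z →* Z).ker ≤ p ^ n := by
    intro n
    induction n with
    | zero =>
      have : (powMonoidHom (p ^ 0) : Z →* Z).ker = ⊥ := by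
        ext x; simp [MonoidHom.mem_ker]
      simp
    | succ n ih =>
      let K := (powMonoidHom (p ^ (n + 1)) : Z →* Z).ker
      let φ : K →* Z := (powMonoidHom p : Z →* Z).comp K.subtype
      have h1 : Nat.card φ.range ≤ p ^ n := by
        refine le_trans (Subgroup.card_le_of_le ?_) ih
        rintro _ ⟨⟨x, hx⟩, rfl⟩
        change (x ^ p) ^ p ^ n = 1
        rw [← pow_mul, ← pow_succ']
        exact hx
      have h2 : Nat.card φ.ker ≤ p := by
        refine le_trans (Nat.card_le_card_of_injective
          (fun x : φ.ker => (⟨x.1.1, x.2⟩ : (powMonoidHom p : Z →* Z).ker)) ?_) h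
        intro x y hxy
        exact Subtype.ext (Subtype.ext (Subtype.ext_iff.mp hxy :))
      have h3 : Nat.card K = Nat.card φ.ker * Nat.card φ.range := by
        rw [← φ.ker.card_mul_index, Subgroup.index_ker]
      calc Nat.card K = Nat.card φ.ker * Nat.card φ.range := h3
        _ ≤ p * p ^ n := by gcongr
        _ = p ^ (n + 1) := by rw [pow_succ']
  have := Fintype.ofFinite Z
  refine isCyclic_of_card_pow_eq_one_le fun n hn => ?_
  obtain ⟨m, hm⟩ := IsPGroup.iff_card.mp hZ
  -- Only `gcd(n, |Z|)`, a power of `p`, matters for the solutions of `a ^ n = 1`.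
  obtain ⟨j, hj, hg⟩ := (Nat.dvd_prime_pow hp).mp (Nat.gcd_dvd_right n (p ^ m))
  have hle : (Finset.univ.filter fun a : Z => a ^ n = 1).card ≤
      Nat.card (powMonoidHom (p ^ j) : Z →* Z).ker := by
    rw [← Fintype.card_subtype, ← Nat.card_eq_fintype_card]
    refine Nat.card_le_card_of_injective
      (fun a : {a : Z // a ^ n = 1} => (⟨a.1, ?_⟩ : (powMonoidHom (p ^ j) : Z →* Z).ker)) ?_
    · change a.1 ^ p ^ j = 1
      rw [← hg, ← orderOf_dvd_iff_pow_eq_one, Nat.dvd_gcd_iff]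
      exact ⟨orderOf_dvd_of_pow_eq_one a.2, hm ▸ orderOf_dvd_natCard a.1⟩
    · exact fun a b hab => Subtype.ext (Subtype.ext_iff.mp hab :)
  calc _ ≤ _ := hle
    _ ≤ p ^ j := key j
    _ ≤ n := hg ▸ Nat.gcd_le_left _ hn

/-- A noncyclic `Z` contains two subgroups of order `p` with trivial intersection; pairs of
homomorphisms to them multiply injectively. -/
theorem IsPGroup.card_monoidHom_sq_le {p : ℕ} [Fact p.Prime] {G Z C : Type*} [Group G] [Finite G]
    [CommGroup Z] [Finite Z] [CommGroup C] (hC : Nat.card C = p)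
    (hZ : IsPGroup p Z) (hcyc : ¬ IsCyclic Z) :
    Nat.card (G →* C) ^ 2 ≤ Nat.card (G →* Z) := by
  have hp : p.Prime := Fact.out
  have : Finite C := Nat.finite_of_card_ne_zero (by rw [hC]; exact hp.ne_zero)
  set K := (powMonoidHom p : Z →* Z).ker with hK
  have hlt : p < Nat.card K := by
    by_contra! h
    exact hcyc (hZ.isCyclic_of_card_ker_pow_le h)
  have hord : ∀ x ∈ K, x ≠ 1 → Nat.card (Subgroup.zpowers x) = p := fun x hx h1 => by
    rw [Nat.card_zpowers]
    exact orderOf_eq_prime hx h1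
  obtain ⟨x, hxK, hx⟩ : ∃ x ∈ K, x ≠ 1 := by
    by_contra! h
    rw [(Subgroup.eq_bot_iff_forall K).mpr h, Subgroup.card_bot] at hlt
    exact absurd hp.one_lt (by omega)
  obtain ⟨y, hyK, hy⟩ : ∃ y ∈ K, y ∉ Subgroup.zpowers x := by
    by_contra! h
    have := Subgroup.card_le_of_le (show K ≤ Subgroup.zpowers x from h)
    rw [hord x hxK hx] at this
    omega
  have hy1 : y ≠ 1 := fun h => hy (h ▸ one_mem _)
  have hdis : Disjoint (Subgroup.zpowers x) (Subgroup.zpowers y) := by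
    rcases (hord y hyK hy1 ▸ ‹Fact p.Prime› : Fact (Nat.card (Subgroup.zpowers y)).Prime) with ⟨hpr⟩
    have := Fact.mk hpr
    rcases ((Subgroup.zpowers x).subgroupOf (Subgroup.zpowers y)).eq_bot_or_eq_top_of_prime_card
      with h | h
    · exact (Subgroup.subgroupOf_eq_bot).mp h
    · exact absurd (Subgroup.subgroupOf_eq_top.mp h (Subgroup.mem_zpowers y)) hy
  let e : C ≃* Subgroup.zpowers x := mulEquivOfPrimeCardEq (p := p) hC (hord x hxK hx)
  let e' : C ≃* Subgroup.zpowers y := mulEquivOfPrimeCardEq (p := p) hC (hord y hyK hy1)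
  let F : (G →* C) × (G →* C) → (G →* Z) := fun q =>
    ((Subgroup.zpowers x).subtype.comp (e.toMonoidHom.comp q.1)) *
      ((Subgroup.zpowers y).subtype.comp (e'.toMonoidHom.comp q.2))
  have hF : Function.Injective F := by
    rintro ⟨f, g⟩ ⟨f', g'⟩ h
    have key : ∀ u : G, f u = f' u ∧ g u = g' u := by
      intro u
      have h1 : (e (f u) : Z) * (e' (g u) : Z) = e (f' u) * e' (g' u) := DFunLike.congr_fun h u
      have h2 := Subgroup.mul_injective_of_disjoint hdis
        (a₁ := (e (f u), e' (g u))) (a₂ := (e (f' u), e' (g' u))) h1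
      simpa using h2
    exact Prod.ext (MonoidHom.ext fun u => (key u).1) (MonoidHom.ext fun u => (key u).2)
  calc Nat.card (G →* C) ^ 2 = Nat.card ((G →* C) × (G →* C)) := by rw [Nat.card_prod, sq]
    _ ≤ _ := Nat.card_le_card_of_injective F hF

/-! ### Groups with central quotient of order `p²` -/

theorem Group.commute_of_isCyclic_quotient {G : Type*} [Group G] (N : Subgroup G) [N.Normal]
    [IsCyclic (G ⧸ N)] (h : N ≤ Subgroup.center G) (a b : G) : a * b = b * a :=
  (MonoidHom.isMulCommutative_of_isCyclic_of_ker_le_center (QuotientGroup.mk' N)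
    (by rwa [QuotientGroup.ker_mk'])).is_comm.comm a b

theorem exists_mul_ne_of_index_center_eq_sq {p : ℕ} [Fact p.Prime] {Q : Type*} [Group Q]
    (hidx : (Subgroup.center Q).index = p ^ 2) : ∃ x y : Q, x * y ≠ y * x := by
  by_contra! h
  have : Subgroup.center Q = ⊤ :=
    eq_top_iff.mpr fun x _ => Subgroup.mem_center_iff.mpr fun y => h y x
  rw [this, Subgroup.index_top] at hidx
  exact absurd hidx (Nat.one_lt_pow (by norm_num) (Fact.out : p.Prime).one_lt).ne

theorem pow_eq_one_of_card_eq_sq_of_not_isCyclic {p : ℕ} [Fact p.Prime] {Q : Type*} [Group Q]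
    (hQ : Nat.card Q = p ^ 2) (hcyc : ¬ IsCyclic Q) (x : Q) : x ^ p = 1 := by
  have hp : p.Prime := Fact.out
  rw [← orderOf_dvd_iff_pow_eq_one]
  have hd : orderOf x ∣ p ^ 2 := hQ ▸ orderOf_dvd_natCard _
  have : Finite Q := Nat.finite_of_card_ne_zero (by rw [hQ]; exact pow_ne_zero _ hp.ne_zero)
  obtain ⟨j, hj, ho⟩ := (Nat.dvd_prime_pow hp).mp hd
  have hj2 : j ≠ 2 := by
    rintro rfl
    exact hcyc (isCyclic_of_orderOf_eq_card x (ho.trans hQ.symm))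
  rw [ho]
  exact pow_dvd_pow p (by omega : j ≤ 1) |>.trans (by simp)

theorem pow_mem_center_of_index_center_eq_sq {p : ℕ} [Fact p.Prime] {Q : Type*} [Group Q]
    (hidx : (Subgroup.center Q).index = p ^ 2) (x : Q) : x ^ p ∈ Subgroup.center Q := by
  rw [← QuotientGroup.eq_one_iff, QuotientGroup.mk_pow]
  refine pow_eq_one_of_card_eq_sq_of_not_isCyclic hidx (fun _ => ?_) _
  obtain ⟨a, b, hab⟩ := exists_mul_ne_of_index_center_eq_sq hidx
  exact hab (Group.commute_of_isCyclic_quotient _ le_rfl a b)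

open scoped commutatorElement in
-- Two noncommuting elements `x`, `y` generate `Q` together with its center. Modulo the central
-- subgroup generated by `⁅x, y⁆` everything commutes, so this commutator, whose order divides `p`,
-- generates `Q'`.
theorem card_commutator_le_of_index_center_eq_sq {p : ℕ} [Fact p.Prime] {Q : Type*} [Group Q]
    [Finite Q] (hidx : (Subgroup.center Q).index = p ^ 2)
    (hle : commutator Q ≤ Subgroup.center Q) : Nat.card (commutator Q) ≤ p := by
  have hp : p.Prime := Fact.out
  set W := Subgroup.center Q with hW
  have hpow : ∀ x : Q, x ^ p ∈ W := pow_mem_center_of_index_center_eq_sq hidx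
  obtain ⟨x, y, hxy⟩ := exists_mul_ne_of_index_center_eq_sq hidx
  -- If `L` were proper, `L/W` would have order 1 or `p`, hence be cyclic, and `x`, `y` would
  -- commute.
  have htop : ∀ L : Subgroup Q, W ≤ L → x ∈ L → y ∈ L → L = ⊤ := by
    intro L hWL hx hy
    have hd : L.index ∣ p ^ 2 := hidx ▸ Subgroup.index_dvd_of_le hWL
    have hmul := Subgroup.relIndex_mul_index hWL
    obtain ⟨j, hj, hL⟩ := (Nat.dvd_prime_pow hp).mp hd
    have hcomm : ¬ IsCyclic (L ⧸ W.subgroupOf L) := by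
      intro h
      refine hxy (congrArg Subtype.val (Group.commute_of_isCyclic_quotient
        (W.subgroupOf L) ?_ ⟨x, hx⟩ ⟨y, hy⟩))
      intro a ha
      exact Subgroup.mem_center_iff.mpr fun b => Subtype.ext (Subgroup.mem_center_iff.mp ha b)
    have hcard : Nat.card (L ⧸ W.subgroupOf L) = W.relIndex L := rfl
    interval_cases j
    · simpa using hL
    · exfalso
      refine hcomm (isCyclic_of_prime_card (p := p) ?_)
      rw [hcard]
      rw [hL, hidx, pow_one, sq] at hmul
      exact Nat.eq_of_mul_eq_mul_right hp.pos hmul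
    · exfalso
      have h1 : W.relIndex L = 1 := by
        rw [hL, hidx] at hmul
        exact Nat.eq_of_mul_eq_mul_right (pow_pos hp.pos 2) (hmul.trans (one_mul _).symm)
      have := (Nat.card_eq_one_iff_unique.mp (hcard.trans h1)).1
      exact hcomm inferInstance
  set c := ⁅x, y⁆ with hc
  have hcW : c ∈ W := hle (Subgroup.commutator_mem_commutator (Subgroup.mem_top x) (Subgroup.mem_top y))
  have hcc : ∀ u, u * c = c * u := Subgroup.mem_center_iff.mp hcW
  -- Since `c * y` is a conjugate of `y` and `y ^ p` is central, `(c * y) ^ p = y ^ p`.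
  have hcp : c ^ p = 1 := by
    have h1 : c * y = x * y * x⁻¹ := by rw [hc, commutatorElement_def]; group
    have h2 : (c * y) ^ p = c ^ p * y ^ p := (Commute.mul_pow (hcc y).symm p)
    rw [h1, conj_pow, Subgroup.mem_center_iff.mp (hpow y) x, mul_inv_cancel_right] at h2
    exact (mul_eq_right.mp h2.symm)
  set I := Subgroup.zpowers c with hI
  have hIW : I ≤ W := by rwa [hI, Subgroup.zpowers_le]
  have hIn : I.Normal := ⟨fun a ha u => by
    rw [Subgroup.mem_center_iff.mp (hIW ha) u, mul_inv_cancel_right]; exact ha⟩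
  have hcomm_iff : ∀ u v : Q, (u : Q ⧸ I) * v = v * u ↔ ⁅u, v⁆ ∈ I := by
    intro u v
    rw [← QuotientGroup.eq_one_iff, commutatorElement_def]
    simp only [QuotientGroup.mk_mul, QuotientGroup.mk_inv]
    rw [mul_inv_eq_one, mul_inv_eq_iff_eq_mul]
  have hxyI : (x : Q ⧸ I) * y = y * x := (hcomm_iff x y).mpr (Subgroup.mem_zpowers c)
  have hcent : ∀ a : Q, (a : Q ⧸ I) * x = x * a → (a : Q ⧸ I) * y = y * a →
      ∀ u : Q, (a : Q ⧸ I) * u = u * a := by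
    intro a hax hay u
    have := htop ((Subgroup.centralizer {(a : Q ⧸ I)}).comap (QuotientGroup.mk' I)) ?_ ?_ ?_
    · have hu : u ∈ (Subgroup.centralizer {(a : Q ⧸ I)}).comap (QuotientGroup.mk' I) :=
        this ▸ Subgroup.mem_top u
      simpa [Subgroup.mem_centralizer_iff] using hu
    · intro w hw
      have : (a : Q ⧸ I) * w = w * a := by
        rw [← QuotientGroup.mk_mul, ← QuotientGroup.mk_mul, Subgroup.mem_center_iff.mp hw a]
      simpa [Subgroup.mem_centralizer_iff] using this
    · simpa [Subgroup.mem_centralizer_iff] using hax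
    · simpa [Subgroup.mem_centralizer_iff] using hay
  have hQI : commutator Q ≤ I := by
    rw [commutator_def, Subgroup.commutator_le]
    intro u _ v _
    rw [← hcomm_iff]
    exact hcent u (hcent x rfl hxyI u).symm (hcent y hxyI.symm rfl u).symm v
  calc Nat.card (commutator Q) ≤ Nat.card I := Subgroup.card_le_of_le hQI
    _ = orderOf c := Nat.card_zpowers c
    _ ≤ p := orderOf_le_of_pow_eq_one hp.pos hcp

/-! ### Central automorphisms as homomorphisms to the center -/

section CentralAutomorphisms

open scoped IsMulCommutative commutatorElement

theorem commutatorElement_inv_left_eq {G : Type*} [Group G] (x g : G) :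
    ⁅x⁻¹, g⁆ = x⁻¹ * (g * x * g⁻¹) := by
  rw [commutatorElement_def, inv_inv, mul_assoc, mul_assoc, mul_assoc]

theorem mem_secondCenter_iff {G : Type*} [Group G] {g : G} :
    g ∈ secondCenter G ↔ ∀ x, x⁻¹ * (g * x * g⁻¹) ∈ Subgroup.center G := by
  rw [secondCenter, Subgroup.mem_upperCentralSeries_succ_iff, Subgroup.upperCentralSeries_one]
  constructor
  · intro h x
    rw [← commutatorElement_inv_left_eq, ← commutatorElement_inv]
    exact inv_mem (h x⁻¹)
  · intro h x
    have := h x⁻¹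
    rw [← commutatorElement_inv_left_eq, inv_inv] at this
    change ⁅g, x⁆ ∈ _
    rw [← commutatorElement_inv]
    exact inv_mem this

theorem center_le_secondCenter (G : Type*) [Group G] : Subgroup.center G ≤ secondCenter G := by
  rw [← Subgroup.upperCentralSeries_one]
  exact Subgroup.upperCentralSeries_mono G (by norm_num)

/-- The homomorphism sending `g` in the second center to the homomorphism `x ↦ x⁻¹ * g * x * g⁻¹`
with values in the center. -/
def secondCenterHom (G : Type*) [Group G] : secondCenter G →* (G →* Subgroup.center G) :=
  MonoidHom.mk'
    (fun g => MonoidHom.mk' (fun x => ⟨x⁻¹ * (g * x * (g : G)⁻¹), mem_secondCenter_iff.mp g.2 x⟩) (by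
      intro x y
      have h := Subgroup.mem_center_iff.mp (mem_secondCenter_iff.mp g.2 x) y⁻¹
      ext
      change (x * y)⁻¹ * (g * (x * y) * (g : G)⁻¹) =
        x⁻¹ * (g * x * (g : G)⁻¹) * (y⁻¹ * (g * y * (g : G)⁻¹))
      rw [← mul_assoc _ y⁻¹, ← h]
      group))
    (by
      intro g h
      ext x
      have hc := Subgroup.mem_center_iff.mp (mem_secondCenter_iff.mp h.2 x) (g : G)⁻¹
      change x⁻¹ * (((g : G) * h) * x * ((g : G) * h)⁻¹) =
        x⁻¹ * (g * x * (g : G)⁻¹) * (x⁻¹ * (h * x * (h : G)⁻¹))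
      rw [mul_assoc x⁻¹, mul_assoc _ (g : G)⁻¹, hc]
      group)

@[simp]
theorem coe_secondCenterHom_apply {G : Type*} [Group G] (g : secondCenter G) (x : G) :
    (secondCenterHom G g x : G) = x⁻¹ * (g * x * (g : G)⁻¹) := rfl

theorem ker_secondCenterHom (G : Type*) [Group G] :
    (secondCenterHom G).ker = (Subgroup.center G).subgroupOf (secondCenter G) := by
  ext g
  rw [MonoidHom.mem_ker, Subgroup.mem_subgroupOf, Subgroup.mem_center_iff, MonoidHom.ext_iff]
  refine forall_congr' fun x => ?_
  rw [Subtype.ext_iff, coe_secondCenterHom_apply]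
  change x⁻¹ * (g * x * (g : G)⁻¹) = 1 ↔ _
  rw [inv_mul_eq_one, eq_mul_inv_iff_mul_eq]

theorem mem_centerInn_iff {G : Type*} [Group G] {α : MulAut G} :
    α ∈ centerInn G ↔ ∃ g ∈ secondCenter G, MulAut.conj g = α := by
  have hone : ∀ c : G, MulAut.conj c = 1 ↔ c ∈ Subgroup.center G := by
    intro c
    rw [Subgroup.mem_center_iff, MulEquiv.ext_iff]
    refine forall_congr' fun x => ?_
    rw [MulAut.conj_apply, MulAut.one_apply, mul_inv_eq_iff_eq_mul, eq_comm]
  have key : ∀ g h : G, MulAut.conj g * MulAut.conj h = MulAut.conj h * MulAut.conj g ↔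
      h⁻¹ * (g * h * g⁻¹) ∈ Subgroup.center G := by
    intro g h
    rw [← hone, map_mul, map_mul, map_mul, map_inv, map_inv, inv_mul_eq_one, eq_mul_inv_iff_mul_eq,
      eq_comm]
  constructor
  · rintro ⟨⟨β, g, hg⟩, hβ, rfl⟩
    refine ⟨g, mem_secondCenter_iff.mpr fun h => (key g h).mp ?_, hg⟩
    have := Subgroup.mem_center_iff.mp hβ ⟨MulAut.conj h, h, rfl⟩
    rw [hg]
    exact (congrArg Subtype.val this).symm
  · rintro ⟨g, hg, rfl⟩
    refine ⟨⟨MulAut.conj g, g, rfl⟩, Subgroup.mem_center_iff.mpr ?_, rfl⟩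
    rintro ⟨_, h, rfl⟩
    exact Subtype.ext ((key g h).mpr (mem_secondCenter_iff.mp hg h)).symm

theorem centerInn_le_centralAut (G : Type*) [Group G] : centerInn G ≤ centralAut G := by
  intro α hα
  obtain ⟨g, hg, rfl⟩ := mem_centerInn_iff.mp hα
  exact fun x => mem_secondCenter_iff.mp hg x

theorem exists_mem_centralAut {G : Type*} [Group G] [Finite G] (f : G →* Subgroup.center G)
    (hf : ∀ x : G, x * f x = 1 → x = 1) : ∃ α ∈ centralAut G, ∀ x, α x = x * f x := by
  let φ : G →* G := MonoidHom.mk' (fun x => x * f x) (by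
    intro x y
    have := Subgroup.mem_center_iff.mp (f x).2 y
    simp only [map_mul, Subgroup.coe_mul]
    rw [mul_assoc x y, ← mul_assoc y, this]
    simp only [mul_assoc])
  have hinj : Function.Injective φ := (injective_iff_map_eq_one φ).mpr hf
  refine ⟨MulEquiv.ofBijective φ ⟨hinj, Finite.surjective_of_injective hinj⟩, fun x => ?_,
    fun x => rfl⟩
  change x⁻¹ * (x * f x) ∈ _
  simp

theorem exists_secondCenterHom_eq {G : Type*} [Group G] [Finite G]
    (h : centralAut G = centerInn G) (f : G →* Subgroup.center G)
    (hf : ∀ x : G, x * f x = 1 → x = 1) : ∃ g, secondCenterHom G g = f := by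
  obtain ⟨α, hα, hαf⟩ := exists_mem_centralAut f hf
  rw [h] at hα
  obtain ⟨g, hg, rfl⟩ := mem_centerInn_iff.mp hα
  refine ⟨⟨g, hg⟩, MonoidHom.ext fun x => Subtype.ext ?_⟩
  have := hαf x
  rw [MulAut.conj_apply] at this
  simp [this]

theorem secondCenterHom_apply_center {G : Type*} [Group G] (g : secondCenter G) {z : G}
    (hz : z ∈ Subgroup.center G) : secondCenterHom G g z = 1 := by
  ext
  rw [coe_secondCenterHom_apply, Subgroup.mem_center_iff.mp hz]
  simp

theorem MonoidHom.apply_eq_one_of_mem_commutator {G C : Type*} [Group G] [CommGroup C] (f : G →* C)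
    {x : G} (hx : x ∈ commutator G) : f x = 1 :=
  Abelianization.commutator_subset_ker f hx

theorem secondCenter_commute_commutator {G : Type*} [Group G] {g x : G} (hg : g ∈ secondCenter G)
    (hx : x ∈ commutator G) : g * x = x * g := by
  have h := congrArg Subtype.val ((secondCenterHom G ⟨g, hg⟩).apply_eq_one_of_mem_commutator hx)
  rw [coe_secondCenterHom_apply] at h
  change x⁻¹ * (g * x * g⁻¹) = 1 at h
  rwa [inv_mul_eq_one, eq_mul_inv_iff_mul_eq, eq_comm] at h

/-- For a finite group whose center consists of nongenerators, the central automorphisms correspond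
to the homomorphisms into the center. -/
theorem centralAut_eq_centerInn_iff_surjective {G : Type*} [Group G] [Finite G]
    (hfr : ∀ H : Subgroup G, H ⊔ Subgroup.center G = ⊤ → H = ⊤) :
    centralAut G = centerInn G ↔ Function.Surjective (secondCenterHom G) := by
  constructor
  · intro h f
    refine exists_secondCenterHom_eq h f ?_
    let φ : G →* G := MonoidHom.mk' (fun x => x * f x) (by
      intro x y
      have := Subgroup.mem_center_iff.mp (f x).2 y
      simp only [map_mul, Subgroup.coe_mul]
      rw [mul_assoc x y, ← mul_assoc y, this]
      simp only [mul_assoc])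
    -- The image of `φ` together with the center is all of `G`, so the image alone is `G`.
    have hsurj : Function.Surjective φ := by
      rw [← MonoidHom.range_eq_top]
      apply hfr
      refine eq_top_iff.mpr fun x _ => ?_
      have hx : x = φ x * (f x : G)⁻¹ := by simp [φ]
      rw [hx]
      exact Subgroup.mul_mem_sup ⟨x, rfl⟩ (inv_mem (f x).2)
    exact (injective_iff_map_eq_one φ).mp (Finite.injective_iff_surjective.mpr hsurj)
  · intro h
    refine le_antisymm (fun α hα => ?_) (centerInn_le_centralAut G)
    obtain ⟨g, hg⟩ := h (MonoidHom.mk' (fun x => ⟨x⁻¹ * α x, hα x⟩) (by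
      intro x y
      have := Subgroup.mem_center_iff.mp (hα x) y⁻¹
      ext
      change (x * y)⁻¹ * α (x * y) = x⁻¹ * α x * (y⁻¹ * α y)
      rw [← mul_assoc _ y⁻¹, ← this, map_mul]
      group))
    refine mem_centerInn_iff.mpr ⟨g, g.2, MulEquiv.ext fun x => ?_⟩
    have := congrArg Subtype.val (DFunLike.congr_fun hg x)
    exact mul_left_cancel this

/-- The embedding of `Z₂(G)/Z(G)` into the homomorphisms from `G` to its center. -/
noncomputable def secondCenterQuotHom (G : Type*) [Group G] :
    SecondCenterQuot G →* (G →* Subgroup.center G) :=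
  QuotientGroup.lift _ (secondCenterHom G) (ker_secondCenterHom G).ge

theorem secondCenterQuotHom_injective (G : Type*) [Group G] :
    Function.Injective (secondCenterQuotHom G) := by
  rw [injective_iff_map_eq_one]
  intro x
  induction x using QuotientGroup.induction_on with
  | H g =>
    intro h
    rw [QuotientGroup.eq_one_iff, ← ker_secondCenterHom]
    exact h

theorem secondCenterQuotHom_surjective_iff (G : Type*) [Group G] :
    Function.Surjective (secondCenterQuotHom G) ↔ Function.Surjective (secondCenterHom G) := by
  constructor
  · intro h f
    obtain ⟨x, hx⟩ := h f
    obtain ⟨g, rfl⟩ := QuotientGroup.mk_surjective x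
    exact ⟨g, hx⟩
  · intro h f
    obtain ⟨g, hg⟩ := h f
    exact ⟨(g : SecondCenterQuot G), hg⟩

/-! ### When the center consists of nongenerators -/

theorem IsPGroup.exists_monoidHom_center_ne_one {p : ℕ} [Fact p.Prime] {G : Type*} [Group G]
    [Finite G] (hG : IsPGroup p G) {z : G} (hz : z ∈ Subgroup.center G) (ho : orderOf z = p)
    {H : Subgroup G} (hH : H ≠ ⊤) :
    ∃ f : G →* Subgroup.center G, f ≠ 1 ∧ (∀ x ∈ H, f x = 1) ∧
      ∀ x, (f x : G) ∈ Subgroup.zpowers z := by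
  have hC : Nat.card (Subgroup.zpowers (⟨z, hz⟩ : Subgroup.center G)) = p := by
    rw [Nat.card_zpowers, ← ho, ← Subgroup.orderOf_coe]
  obtain ⟨f, hf1, hf⟩ := hG.exists_monoidHom_ne_one hC hH
  refine ⟨(Subgroup.subtype _).comp f, fun h => hf1 (MonoidHom.ext fun x => Subtype.ext ?_),
    fun x hx => ?_, fun x => ?_⟩
  · exact DFunLike.congr_fun h x
  · simp [hf x hx]
  · obtain ⟨n, hn⟩ := Subgroup.mem_zpowers_iff.mp (f x).2
    refine Subgroup.mem_zpowers_iff.mpr ⟨n, ?_⟩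
    have := congrArg Subtype.val hn
    simpa using this

/-- As `f` kills its own image, applying `f` to `x * f x = 1` gives `f x = 1`, hence `x = 1`. -/
theorem exists_secondCenterHom_eq_of_zpowers {G : Type*} [Group G] [Finite G]
    (h : centralAut G = centerInn G) (f : G →* Subgroup.center G) {z : G}
    (hfz : f z = 1) (hf : ∀ x, (f x : G) ∈ Subgroup.zpowers z) :
    ∃ g, secondCenterHom G g = f := by
  refine exists_secondCenterHom_eq h f fun x hx => ?_
  obtain ⟨n, hn⟩ := Subgroup.mem_zpowers_iff.mp (hf x)
  have h1 : f (f x : G) = 1 := by rw [← hn, map_zpow, hfz, one_zpow]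
  have h2 := congrArg f hx
  rw [map_mul, h1, mul_one, map_one] at h2
  rwa [h2, Subgroup.coe_one, mul_one] at hx

theorem IsPGroup.secondCenter_not_le_center {p : ℕ} [Fact p.Prime] {G : Type*} [Group G] [Finite G]
    (hG : IsPGroup p G) (hne : Subgroup.center G ≠ ⊤) :
    ¬ secondCenter G ≤ Subgroup.center G := by
  have hnil := hG.isNilpotent
  intro h
  apply hne
  rw [← Subgroup.upperCentralSeries_one]
  refine Subgroup.upperCentralSeries.eq_top (b := 2) (by norm_num) (le_antisymm ?_ ?_)
  · exact Subgroup.upperCentralSeries_mono G (by norm_num)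
  · rwa [Subgroup.upperCentralSeries_one]

theorem IsPGroup.exists_mem_center_commutator_orderOf_eq {p : ℕ} [Fact p.Prime] {G : Type*}
    [Group G] [Finite G] (hG : IsPGroup p G) (hne : Subgroup.center G ≠ ⊤) :
    ∃ z ∈ Subgroup.center G, z ∈ commutator G ∧ orderOf z = p := by
  obtain ⟨g, hg, hgZ⟩ := SetLike.not_le_iff_exists.mp (hG.secondCenter_not_le_center hne)
  rw [Subgroup.mem_center_iff] at hgZ
  push Not at hgZ
  obtain ⟨x, hx⟩ := hgZ
  have hw : x⁻¹ * (g * x * g⁻¹) ∈ Subgroup.center G ⊓ commutator G := by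
    refine ⟨mem_secondCenter_iff.mp hg x, ?_⟩
    rw [← commutatorElement_inv_left_eq]
    exact Subgroup.commutator_mem_commutator (Subgroup.mem_top x⁻¹) (Subgroup.mem_top g)
  have hnt : Nontrivial (Subgroup.center G ⊓ commutator G : Subgroup G) := by
    refine ⟨⟨⟨_, hw⟩, 1, fun h => hx ?_⟩⟩
    have h1 : x⁻¹ * (g * x * g⁻¹) = 1 := congrArg Subtype.val h
    rwa [inv_mul_eq_one, eq_mul_inv_iff_mul_eq] at h1
  obtain ⟨n, hn, hc⟩ := (hG.to_subgroup (Subgroup.center G ⊓ commutator G)).nontrivial_iff_card.mp hnt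
  obtain ⟨z, hz⟩ := exists_prime_orderOf_dvd_card' (G := (Subgroup.center G ⊓ commutator G : Subgroup G))
    p (hc ▸ dvd_pow_self p hn.ne')
  exact ⟨z, z.2.1, z.2.2, by rw [Subgroup.orderOf_coe, hz]⟩

/-- For proper `H`, take a nontrivial `f` killing `H` with values in a subgroup of order `p` of `Z ∩
G'`. Then `f` kills its own image, so it comes from `Z₂`; such maps also kill `Z`, hence `HZ = G`.
-/
theorem IsPGroup.eq_top_of_sup_center_of_centralAut {p : ℕ} [Fact p.Prime] {G : Type*} [Group G]
    [Finite G] (hG : IsPGroup p G) (hne : Subgroup.center G ≠ ⊤)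
    (h : centralAut G = centerInn G) (H : Subgroup G) (hH : H ⊔ Subgroup.center G = ⊤) : H = ⊤ := by
  by_contra hHt
  obtain ⟨z, hz, hzc, ho⟩ := hG.exists_mem_center_commutator_orderOf_eq hne
  obtain ⟨f, hf1, hfH, hf⟩ := hG.exists_monoidHom_center_ne_one hz ho hHt
  obtain ⟨g, rfl⟩ := exists_secondCenterHom_eq_of_zpowers h f
    (f.apply_eq_one_of_mem_commutator hzc) hf
  refine hf1 (MonoidHom.ext fun x => ?_)
  have hle : H ⊔ Subgroup.center G ≤ (secondCenterHom G g).ker :=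
    sup_le hfH fun x hx => secondCenterHom_apply_center g hx
  exact hle (hH ▸ Subgroup.mem_top x)

theorem IsPGroup.eq_top_of_sup_center_of_le_commutator {p : ℕ} [Fact p.Prime] {G : Type*} [Group G]
    [Finite G] (hG : IsPGroup p G) (hle : Subgroup.center G ≤ commutator G)
    (H : Subgroup G) (hH : H ⊔ Subgroup.center G = ⊤) : H = ⊤ := by
  by_contra hHt
  obtain ⟨f, hf1, hfH⟩ := hG.exists_monoidHom_ne_one (C := Multiplicative (ZMod p)) (by simp) hHt
  refine hf1 (MonoidHom.ext fun x => ?_)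
  have : H ⊔ Subgroup.center G ≤ f.ker :=
    sup_le hfH fun x hx => f.apply_eq_one_of_mem_commutator (hle hx)
  exact this (hH ▸ Subgroup.mem_top x)

theorem IsPGroup.centralAut_ne_centerInn_of_center_eq_top {p : ℕ} [Fact p.Prime] {G : Type*}
    [Group G] [Finite G] (hG : IsPGroup p G) (hcard : p < Nat.card G)
    (htop : Subgroup.center G = ⊤) : centralAut G ≠ centerInn G := by
  intro h
  have hp : p.Prime := Fact.out
  have hnt : Nontrivial G := Finite.one_lt_card_iff_nontrivial.mp (hp.one_lt.trans hcard)
  obtain ⟨n, hn, hc⟩ := hG.nontrivial_iff_card.mp hnt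
  obtain ⟨z, hz⟩ := exists_prime_orderOf_dvd_card' (G := G) p (hc ▸ dvd_pow_self p hn.ne')
  have hH : Subgroup.zpowers z ≠ ⊤ := by
    intro ht
    have := Nat.card_zpowers z
    rw [ht, Subgroup.card_top, hz] at this
    omega
  obtain ⟨f, hf1, hfH, hf⟩ := hG.exists_monoidHom_center_ne_one (htop ▸ Subgroup.mem_top z) hz hH
  obtain ⟨g, rfl⟩ := exists_secondCenterHom_eq_of_zpowers h f (hfH z (Subgroup.mem_zpowers z)) hf
  exact hf1 (MonoidHom.ext fun x => secondCenterHom_apply_center g (htop ▸ Subgroup.mem_top x))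

/-! ### Orders in the upper central series -/

theorem Subgroup.index_comap_mk {G : Type*} [Group G] (N : Subgroup G) [N.Normal]
    (K : Subgroup (G ⧸ N)) : (K.comap (QuotientGroup.mk' N)).index = K.index :=
  K.index_comap_of_surjective (QuotientGroup.mk'_surjective N)

theorem comap_center_quotient_center (G : Type*) [Group G] :
    (Subgroup.center (G ⧸ Subgroup.center G)).comap (QuotientGroup.mk' (Subgroup.center G)) =
      secondCenter G := by
  have := Subgroup.comap_upperCentralSeries_quotient_center (G := G) 1
  rwa [Subgroup.upperCentralSeries_one (G ⧸ Subgroup.center G)] at this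

/-- A group modulo its center is never cyclic and nontrivial; this is applied to `G/Z_n`. -/
theorem IsPGroup.sq_le_index_of_upperCentralSeries {p : ℕ} [Fact p.Prime] {G : Type*} [Group G]
    [Finite G] (hG : IsPGroup p G) {n : ℕ}
    (hn : Subgroup.upperCentralSeries G (n + 1) ≠ ⊤) :
    p ^ 2 ≤ (Subgroup.upperCentralSeries G (n + 1)).index := by
  have hp : p.Prime := Fact.out
  obtain ⟨j, hj⟩ := hG.index (Subgroup.upperCentralSeries G (n + 1))
  rw [hj]
  refine Nat.pow_le_pow_right hp.pos ?_
  by_contra! hj2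
  set N := Subgroup.upperCentralSeries G n
  have hcomap : Subgroup.upperCentralSeries G (n + 1) =
      (Subgroup.center (G ⧸ N)).comap (QuotientGroup.mk' N) :=
    Subgroup.upperCentralSeriesStep_eq_comap_center N
  rw [hcomap, Subgroup.index_comap_mk] at hj
  have hcyc : IsCyclic ((G ⧸ N) ⧸ Subgroup.center (G ⧸ N)) := by
    interval_cases j
    · have := (Nat.card_eq_one_iff_unique.mp hj).1
      infer_instance
    · exact isCyclic_of_prime_card (p := p) (hj.trans (pow_one p))
  apply hn
  rw [hcomap, eq_top_iff]
  intro x _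
  exact Subgroup.mem_center_iff.mpr fun y => Group.commute_of_isCyclic_quotient _ le_rfl y _

theorem IsPGroup.card_mul_pow_le_card_upperCentralSeries {p : ℕ} [Fact p.Prime] {G : Type*}
    [Group G] [Finite G] (hG : IsPGroup p G) (i d : ℕ) (h : i + d ≤ Group.nilpotencyClass G) :
    Nat.card (Subgroup.upperCentralSeries G i) * p ^ d ≤
      Nat.card (Subgroup.upperCentralSeries G (i + d)) := by
  have hp : p.Prime := Fact.out
  induction d with
  | zero => simp
  | succ d ih =>
    have hlt : Subgroup.upperCentralSeries G (i + d) < Subgroup.upperCentralSeries G (i + (d + 1)) :=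
      Subgroup.upperCentralSeries.StrictMonoOn G (Set.mem_Iic.mpr (by omega)) (Set.mem_Iic.mpr h)
        (by omega)
    obtain ⟨a, ha⟩ := IsPGroup.iff_card.mp (hG.to_subgroup (Subgroup.upperCentralSeries G (i + d)))
    obtain ⟨b, hb⟩ :=
      IsPGroup.iff_card.mp (hG.to_subgroup (Subgroup.upperCentralSeries G (i + (d + 1))))
    have hab : p ^ a < p ^ b := by
      rw [← ha, ← hb]
      refine lt_of_le_of_ne (Subgroup.card_le_of_le hlt.le) fun h => hlt.ne ?_
      exact Subgroup.eq_of_le_of_card_ge hlt.le h.ge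
    have := ih (by omega)
    calc _ = Nat.card (Subgroup.upperCentralSeries G i) * p ^ d * p := by rw [pow_succ, mul_assoc]
      _ ≤ p ^ a * p := by rw [← ha]; gcongr
      _ = p ^ (a + 1) := (pow_succ p a).symm
      _ ≤ p ^ b := Nat.pow_le_pow_right hp.pos ((Nat.pow_lt_pow_iff_right hp.one_lt).mp hab)
      _ = _ := hb.symm

theorem card_secondCenter (G : Type*) [Group G] :
    Nat.card (secondCenter G) = Nat.card (Subgroup.center G) * Nat.card (SecondCenterQuot G) := by
  rw [Subgroup.card_eq_card_quotient_mul_card_subgroup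
    ((Subgroup.center G).subgroupOf (secondCenter G)), mul_comm,
    Nat.card_congr (Subgroup.subgroupOfEquivOfLe (center_le_secondCenter G)).toEquiv]

/-- Above `Z₂` the series has `c - 2` further factors, each of order at least `p`, and the last of
order at least `p²`. -/
theorem IsPGroup.add_le_of_card_center_eq {p : ℕ} [Fact p.Prime] {G : Type*} [Group G] [Finite G]
    {n k m : ℕ} (hG : Nat.card G = p ^ n) (hc : 3 ≤ Group.nilpotencyClass G)
    (hk : Nat.card (Subgroup.center G) = p ^ k) (hm : Nat.card (SecondCenterQuot G) = p ^ m) :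
    k + m + Group.nilpotencyClass G ≤ n + 1 := by
  have hp : p.Prime := Fact.out
  have hGp := IsPGroup.of_card hG
  have hnil := hGp.isNilpotent
  obtain ⟨d, hd⟩ : ∃ d, Group.nilpotencyClass G = 2 + d + 1 :=
    ⟨Group.nilpotencyClass G - 3, by omega⟩
  have h1 := hGp.card_mul_pow_le_card_upperCentralSeries 2 d (by omega)
  have hne : Subgroup.upperCentralSeries G (1 + d + 1) ≠ ⊤ := by
    rw [ne_eq, Subgroup.upperCentralSeries_eq_top_iff_nilpotencyClass_le]
    omega
  have h2 := hGp.sq_le_index_of_upperCentralSeries hne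
  rw [show 1 + d + 1 = 2 + d by omega] at h2
  have h3 := (Subgroup.upperCentralSeries G (2 + d)).card_mul_index
  have h4 : p ^ (k + m + d + 2) ≤ p ^ n := by
    rw [← hG, ← h3, pow_add, pow_add, pow_add, ← hk, ← hm, ← card_secondCenter]
    exact Nat.mul_le_mul h1 h2
  have := (Nat.pow_le_pow_iff_right hp.one_lt).mp h4
  omega

theorem commutator_le_upperCentralSeries {G : Type*} [Group G] {n : ℕ}
    (h : Subgroup.upperCentralSeries G (n + 1) = ⊤) :
    commutator G ≤ Subgroup.upperCentralSeries G n := by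
  rw [commutator_def, Subgroup.commutator_le]
  intro x _ y _
  exact Subgroup.mem_upperCentralSeries_succ_iff.mp (h ▸ Subgroup.mem_top x) y

/-! ### Counting homomorphisms through the abelianization -/

/-- Homomorphisms to an abelian group factor through the abelianization. -/
def Abelianization.monoidHomEquiv (G C : Type*) [Group G] [CommGroup C] :
    (Abelianization G →* C) ≃* (G →* C) where
  toEquiv := Abelianization.lift.symm
  map_mul' _ _ := rfl

theorem card_abelianization (G : Type*) [Group G] :
    Nat.card (Abelianization G) = (commutator G).index := rfl

theorem IsPGroup.pow_abelianization_eq_one {p k : ℕ} [Fact p.Prime] {G C : Type*} [Group G]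
    [Finite G] [CommGroup C] [IsCyclic C] (hG : IsPGroup p G) (hC : Nat.card C = p ^ k)
    (hk : 2 ≤ k) (h : ∀ f : G →* C, f ^ p = 1) (a : Abelianization G) : a ^ p = 1 := by
  have hA : IsPGroup p (Abelianization G) := hG.to_quotient _
  refine hA.pow_prime_eq_one_of_monoidHom hC hk (fun f => ?_) a
  apply (Abelianization.monoidHomEquiv G C).injective
  rw [map_pow, h, map_one]

theorem nonempty_monoidHom_mulEquiv_abelianization {G C : Type*} [Group G] [Finite G] [CommGroup C]
    [Finite C] [IsCyclic C] (h : ∀ a : Abelianization G, a ^ Nat.card C = 1) :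
    Nonempty ((G →* C) ≃* Abelianization G) := by
  obtain ⟨e⟩ := CommGroup.nonempty_monoidHom_mulEquiv (A := Abelianization G) (C := C)
    (Monoid.exponent_dvd_of_forall_pow_eq_one h)
  exact ⟨(Abelianization.monoidHomEquiv G C).symm.trans e⟩

theorem Group.two_le_rank_of_center_ne_top {G : Type*} [Group G] [Finite G]
    (hne : Subgroup.center G ≠ ⊤) : 2 ≤ Group.rank G := by
  by_contra! h
  have := Group.isCyclic_of_rank_le_one (G := G) (by omega)
  refine hne (eq_top_iff.mpr fun x _ => Subgroup.mem_center_iff.mpr fun y => ?_)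
  have : IsCyclic (G ⧸ (⊥ : Subgroup G)) := inferInstance
  exact Group.commute_of_isCyclic_quotient ⊥ bot_le y x

theorem exists_card_zpowers_eq_prime {p : ℕ} [Fact p.Prime] {Z : Type*} [Group Z]
    [Finite Z] {k : ℕ} (hZ : Nat.card Z = p ^ k) (hk : k ≠ 0) :
    ∃ z : Z, Nat.card (Subgroup.zpowers z) = p := by
  obtain ⟨z, hz⟩ := exists_prime_orderOf_dvd_card' (G := Z) p (hZ ▸ dvd_pow_self p hk)
  exact ⟨z, by rw [Nat.card_zpowers, hz]⟩

theorem MonoidHom.comp_subtype_injective (G : Type*) {Z : Type*} [Group G] [Group Z]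
    (C : Subgroup Z) : Function.Injective (fun f : G →* C => C.subtype.comp f) := fun _ _ h =>
  MonoidHom.ext fun x => Subtype.ext (DFunLike.congr_fun h x :)

theorem IsPGroup.pow_rank_le_card_monoidHom {p : ℕ} [Fact p.Prime] {G Z : Type*} [Group G]
    [Finite G] (hG : IsPGroup p G) [CommGroup Z] [Finite Z] {k : ℕ} (hZ : Nat.card Z = p ^ k)
    (hk : k ≠ 0) : p ^ Group.rank G ≤ Nat.card (G →* Z) := by
  obtain ⟨z, hz⟩ := exists_card_zpowers_eq_prime hZ hk
  rw [hG.pow_rank_eq_card_monoidHom hz]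
  exact Nat.card_le_card_of_injective _ (MonoidHom.comp_subtype_injective G _)

/-- The homomorphisms into one subgroup of order `p` already number `p ^ Group.rank G`, so there are
no others. -/
theorem IsPGroup.monoidHom_pow_eq_one_of_card_eq {p : ℕ} [Fact p.Prime] {G Z : Type*} [Group G]
    [Finite G] (hG : IsPGroup p G) [CommGroup Z] [Finite Z] {k : ℕ} (hZ : Nat.card Z = p ^ k)
    (hk : k ≠ 0) (h : Nat.card (G →* Z) ≤ p ^ Group.rank G) (f : G →* Z) : f ^ p = 1 := by
  obtain ⟨z, hz⟩ := exists_card_zpowers_eq_prime hZ hk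
  rw [hG.pow_rank_eq_card_monoidHom hz] at h
  have hb := (Nat.bijective_iff_injective_and_card _).mpr ⟨MonoidHom.comp_subtype_injective G
    (Subgroup.zpowers z), le_antisymm (Nat.card_le_card_of_injective _
      (MonoidHom.comp_subtype_injective G _)) h⟩
  obtain ⟨φ, rfl⟩ := hb.2 f
  ext x
  have : φ x ^ p = 1 := hz ▸ pow_card_eq_one'
  exact congrArg Subtype.val this

theorem IsPGroup.pow_rank_eq_card_of_pow_eq_one {p : ℕ} [Fact p.Prime] {A : Type*} [CommGroup A]
    [Finite A] (hA : ∀ a : A, a ^ p = 1) : p ^ Group.rank A = Nat.card A := by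
  have hAp : IsPGroup p A := fun a => ⟨1, by simpa using hA a⟩
  have hC : Nat.card (Multiplicative (ZMod p)) = p := by simp
  rw [hAp.pow_rank_eq_card_monoidHom hC]
  obtain ⟨e⟩ := CommGroup.nonempty_monoidHom_mulEquiv (A := A) (C := Multiplicative (ZMod p))
    (Monoid.exponent_dvd_of_forall_pow_eq_one (by simpa using hA))
  exact Nat.card_congr e.toEquiv

/-! ### Excluding a larger cyclic center when `G' ≤ Z₂` -/

theorem pow_mem_secondCenter_of_index_eq_sq {p : ℕ} [Fact p.Prime] {G : Type*} [Group G]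
    (h : (secondCenter G).index = p ^ 2) (x : G) : x ^ p ∈ secondCenter G := by
  rw [← comap_center_quotient_center] at h ⊢
  rw [Subgroup.index_comap_mk] at h
  rw [Subgroup.mem_comap, map_pow]
  exact pow_mem_center_of_index_center_eq_sq h _

theorem commutator_not_le_center_of_index_eq_sq {p : ℕ} [Fact p.Prime] {G : Type*} [Group G]
    (h : (secondCenter G).index = p ^ 2) : ¬ commutator G ≤ Subgroup.center G := by
  intro hle
  rw [← comap_center_quotient_center, Subgroup.index_comap_mk] at h
  obtain ⟨x, y, hxy⟩ := exists_mul_ne_of_index_center_eq_sq h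
  obtain ⟨x, rfl⟩ := QuotientGroup.mk_surjective x
  obtain ⟨y, rfl⟩ := QuotientGroup.mk_surjective y
  apply hxy
  have h1 : ⁅x, y⁆ ∈ Subgroup.center G :=
    hle (Subgroup.commutator_mem_commutator (Subgroup.mem_top x) (Subgroup.mem_top y))
  rw [← QuotientGroup.eq_one_iff] at h1
  exact commutatorElement_eq_one_iff_mul_comm.mp h1

/-- If `G/Z₂(G)` has order `p²` and `G' ≤ Z₂(G)`, then `G' Z(G)/Z(G)` has order at most `p`. -/
theorem index_center_le_mul_index_commutator {p : ℕ} [Fact p.Prime] {G : Type*} [Group G] [Finite G]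
    (h : (secondCenter G).index = p ^ 2) (hle : commutator G ≤ secondCenter G) :
    (Subgroup.center G).index ≤ p * (commutator G).index := by
  rw [← comap_center_quotient_center, Subgroup.index_comap_mk] at h
  have hmap : (commutator G).map (QuotientGroup.mk' (Subgroup.center G)) =
      commutator (G ⧸ Subgroup.center G) := by
    rw [commutator_def, commutator_def, Subgroup.map_commutator,
      Subgroup.map_top_of_surjective _ (QuotientGroup.mk'_surjective _)]
  have hQ : commutator (G ⧸ Subgroup.center G) ≤ Subgroup.center (G ⧸ Subgroup.center G) := by
    rw [← hmap, Subgroup.map_le_iff_le_comap, comap_center_quotient_center]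
    exact hle
  have hcard := card_commutator_le_of_index_center_eq_sq h hQ
  have hidx : (commutator (G ⧸ Subgroup.center G)).index ≤ (commutator G).index := by
    rw [← Subgroup.index_comap_mk]
    refine Nat.le_of_dvd (Nat.pos_of_ne_zero Subgroup.index_ne_zero_of_finite)
      (Subgroup.index_dvd_of_le ?_)
    rw [← Subgroup.map_le_iff_le_comap, hmap]
  calc (Subgroup.center G).index = Nat.card (G ⧸ Subgroup.center G) := rfl
    _ = Nat.card (commutator (G ⧸ Subgroup.center G)) *
        (commutator (G ⧸ Subgroup.center G)).index := (Subgroup.card_mul_index _).symm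
    _ ≤ _ := Nat.mul_le_mul hcard hidx

theorem secondCenterHom_mem_commutator {G : Type*} [Group G] (g : secondCenter G) (x : G) :
    (secondCenterHom G g x : G) ∈ commutator G := by
  rw [coe_secondCenterHom_apply, ← commutatorElement_inv_left_eq]
  exact Subgroup.commutator_mem_commutator (Subgroup.mem_top _) (Subgroup.mem_top _)

/-- If `k ≥ 2`, then `(k, m)` is `(2, 2)`, `(3, 2)` or `(2, 3)`. Each is refuted by comparing
`|G/G'|`, found by duality with `Hom(G, Z)`, with the bounds coming from `G' ≤ Z₂` and, when `|G/Z₂|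
= p²`, from `|G'Z/Z| ≤ p`. -/
theorem IsPGroup.card_center_eq_prime_of_commutator_le_secondCenter {p : ℕ} [Fact p.Prime]
    {G : Type*} [Group G] [Finite G] {k m : ℕ} (hG : Nat.card G = p ^ 7)
    (hs : Function.Surjective (secondCenterHom G)) (hle : commutator G ≤ secondCenter G)
    (hcyc : IsCyclic (Subgroup.center G)) (hrank : 2 ≤ Group.rank G)
    (hk : Nat.card (Subgroup.center G) = p ^ k) (hm : Nat.card (SecondCenterQuot G) = p ^ m)
    (hH : Nat.card (G →* Subgroup.center G) = p ^ m) (hm2 : 2 ≤ m) (hkm : k + m ≤ 5) : k ≤ 1 := by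
  have hp : p.Prime := Fact.out
  have hGp := IsPGroup.of_card hG
  by_contra! hk2
  have hZ2 : Nat.card (secondCenter G) = p ^ (k + m) := by rw [card_secondCenter, hk, hm, pow_add]
  have hidx : (secondCenter G).index = p ^ (7 - (k + m)) := by
    have := (secondCenter G).card_mul_index
    rw [hZ2, hG, show 7 = (k + m) + (7 - (k + m)) by omega, pow_add p (k + m)] at this
    simpa using Nat.eq_of_mul_eq_mul_left (pow_pos hp.pos _) this
  have hZidx : (Subgroup.center G).index = p ^ (7 - k) := by
    have := (Subgroup.center G).card_mul_index
    rw [hk, hG, show 7 = k + (7 - k) by omega, pow_add p k] at this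
    simpa using Nat.eq_of_mul_eq_mul_left (pow_pos hp.pos _) this
  have hcardA : (∀ f : G →* Subgroup.center G, f ^ p = 1) → (commutator G).index = p ^ m := by
    intro hf
    obtain ⟨e⟩ := nonempty_monoidHom_mulEquiv_abelianization (G := G) (C := Subgroup.center G)
      (fun a => by
        rw [hk, show k = 1 + (k - 1) by omega, pow_add, pow_mul, pow_one,
          hGp.pow_abelianization_eq_one hk hk2 hf, one_pow])
    rw [← card_abelianization, ← Nat.card_congr e.toEquiv, hH]
  have hsq : (secondCenter G).index = p ^ 2 → p ^ (6 - k) ≤ (commutator G).index := by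
    intro h2
    have := index_center_le_mul_index_commutator h2 hle
    rw [hZidx, show 7 - k = (6 - k) + 1 by omega, pow_succ'] at this
    exact Nat.le_of_mul_le_mul_left this hp.pos
  rcases hm2.eq_or_lt with rfl | hm3
  · have hA := hcardA (hGp.monoidHom_pow_eq_one_of_card_eq hk (by omega)
      (by rw [hH]; exact Nat.pow_le_pow_right hp.pos hrank))
    have hd := Subgroup.index_dvd_of_le hle
    rw [hA, hidx, Nat.pow_dvd_pow_iff_le_right hp.one_lt] at hd
    obtain rfl : k = 3 := by omega
    have := hsq hidx
    rw [hA, Nat.pow_le_pow_iff_right hp.one_lt] at this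
    omega
  · obtain rfl : k = 2 := by omega
    obtain rfl : m = 3 := by omega
    replace hsq := hsq hidx
    have hne : (commutator G).index ≠ p ^ 3 := fun h => by
      rw [h, Nat.pow_le_pow_iff_right hp.one_lt] at hsq
      omega
    -- Now `|G/G'| ≥ p⁴`, so not every homomorphism has exponent `p`. A value of order `p²`
    -- generates `Z` and is a commutator, whence `Z ≤ G'`.
    obtain ⟨f, hf⟩ : ∃ f : G →* Subgroup.center G, f ^ p ≠ 1 := by
      by_contra! h
      exact hne (hcardA h)
    obtain ⟨g, rfl⟩ := hs f
    obtain ⟨x, hx⟩ : ∃ x, secondCenterHom G g x ^ p ≠ 1 := by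
      by_contra! h
      exact hf (MonoidHom.ext h)
    have hZle : Subgroup.center G ≤ commutator G := by
      intro z hz
      have hord : orderOf (secondCenterHom G g x) = p ^ (1 + 1) := by
        refine orderOf_eq_prime_pow (by simpa using hx) ?_
        rw [← hk]
        exact pow_card_eq_one'
      have htop : Subgroup.zpowers (secondCenterHom G g x) = ⊤ :=
        Subgroup.eq_top_of_card_eq _ (by rw [Nat.card_zpowers, hord, hk])
      obtain ⟨n, hn⟩ := Subgroup.mem_zpowers_iff.mp
        (htop ▸ Subgroup.mem_top (⟨z, hz⟩ : Subgroup.center G))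
      have hn' : (secondCenterHom G g x : G) ^ n = z := congrArg Subtype.val hn
      rw [← hn']
      exact zpow_mem (secondCenterHom_mem_commutator g x) n
    -- `G'` is central in `Z₂`, so a cyclic quotient would make `Z₂` abelian. Then `g` would commute
    -- with `x ^ p`, contradicting `hx`.
    have hZ2ne : ¬ IsCyclic (secondCenter G ⧸ (commutator G).subgroupOf (secondCenter G)) := by
      intro h
      have hxp := pow_mem_secondCenter_of_index_eq_sq hidx x
      have hcomm := Group.commute_of_isCyclic_quotient
        ((commutator G).subgroupOf (secondCenter G)) (fun a ha => Subgroup.mem_center_iff.mpr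
          fun b => Subtype.ext (secondCenter_commute_commutator b.2 ha)) g ⟨x ^ p, hxp⟩
      apply hx
      rw [← map_pow]
      ext
      have h1 : (g : G) * x ^ p = x ^ p * g := congrArg Subtype.val hcomm
      rw [coe_secondCenterHom_apply, h1]
      simp
    have hG' : Nat.card (commutator G) = p ^ 3 := by
      obtain ⟨a, ha⟩ := IsPGroup.iff_card.mp (hGp.to_subgroup (commutator G))
      have h1 : p ^ 2 < p ^ a := by
        rw [← hk, ← ha]
        refine lt_of_le_of_ne (Subgroup.card_le_of_le hZle) fun h => ?_
        exact commutator_not_le_center_of_index_eq_sq hidx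
          (Subgroup.eq_of_le_of_card_ge hZle h.ge).ge
      have h2 : p ^ (a + 4) ≤ p ^ 7 := by
        rw [← hG, ← (commutator G).card_mul_index, ha, pow_add]
        gcongr
      rw [Nat.pow_lt_pow_iff_right hp.one_lt] at h1
      rw [Nat.pow_le_pow_iff_right hp.one_lt] at h2
      rw [ha, show a = 3 by omega]
    have hquot : Nat.card (secondCenter G ⧸ (commutator G).subgroupOf (secondCenter G)) = p ^ 2 := by
      have := Subgroup.card_eq_card_quotient_mul_card_subgroup
        ((commutator G).subgroupOf (secondCenter G))
      rw [Nat.card_congr (Subgroup.subgroupOfEquivOfLe hle).toEquiv, hG', hZ2, pow_add] at this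
      exact (Nat.eq_of_mul_eq_mul_right (pow_pos hp.pos _) this).symm
    -- `G/Z₂` and `Z₂/G'` both have exponent `p`, so `G/G'` has exponent dividing `p² = |Z|`;
    -- duality then gives `|G/G'| = p³`, against `hne`.
    obtain ⟨e⟩ := nonempty_monoidHom_mulEquiv_abelianization (G := G) (C := Subgroup.center G) (by
      intro a
      obtain ⟨y, rfl⟩ := QuotientGroup.mk_surjective a
      have hyp := pow_mem_secondCenter_of_index_eq_sq hidx y
      have := pow_eq_one_of_card_eq_sq_of_not_isCyclic hquot hZ2ne
        (QuotientGroup.mk ⟨y ^ p, hyp⟩)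
      rw [← QuotientGroup.mk_pow, QuotientGroup.eq_one_iff] at this
      change Abelianization.of y ^ _ = 1
      rw [hk, ← map_pow, ← MonoidHom.mem_ker, Abelianization.ker_of, sq, pow_mul]
      exact this)
    apply hne
    rw [← card_abelianization, ← Nat.card_congr e.toEquiv, hH]

/-! ### Sufficiency of the conditions -/

theorem Group.center_ne_top_of_two_le_nilpotencyClass {G : Type*} [Group G] [Group.IsNilpotent G]
    (h : 2 ≤ Group.nilpotencyClass G) : Subgroup.center G ≠ ⊤ := by
  rw [← Subgroup.upperCentralSeries_one, ne_eq,
    Subgroup.upperCentralSeries_eq_top_iff_nilpotencyClass_le]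
  omega

theorem surjective_secondCenterHom_of_card_eq {G : Type*} [Group G] [Finite G]
    (h : Nat.card (SecondCenterQuot G) = Nat.card (G →* Subgroup.center G)) :
    Function.Surjective (secondCenterHom G) :=
  (secondCenterQuotHom_surjective_iff G).mp ((Nat.bijective_iff_injective_and_card _).mpr
    ⟨secondCenterQuotHom_injective G, h⟩).2

theorem IsPGroup.card_secondCenterQuot {p : ℕ} [Fact p.Prime] {G : Type*} [Group G] [Finite G]
    (hG : IsPGroup p G) : ∃ m, Nat.card (SecondCenterQuot G) = p ^ m :=
  IsPGroup.iff_card.mp ((hG.to_subgroup (secondCenter G)).to_quotient _)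

/-- A nonabelian finite `p`-group with center of order `p` and as many generators as its second
center modulo its center has no central automorphisms apart from inner ones. -/
theorem centralAut_eq_centerInn_of_rank_eq {p : ℕ} [Fact p.Prime] {G : Type*} [Group G] [Finite G]
    (hG : IsPGroup p G) (hne : Subgroup.center G ≠ ⊤) (hZ : Nat.card (Subgroup.center G) = p)
    (hr : Group.rank G = Group.rank (SecondCenterQuot G)) : centralAut G = centerInn G := by
  have hp : p.Prime := Fact.out
  have hZle : Subgroup.center G ≤ commutator G := by
    obtain ⟨z, hz, hzc, ho⟩ := hG.exists_mem_center_commutator_orderOf_eq hne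
    have h1 : Subgroup.zpowers z = Subgroup.center G := by
      refine Subgroup.eq_of_le_of_card_ge (Subgroup.zpowers_le.mpr hz) ?_
      rw [Nat.card_zpowers, ho, hZ]
    rw [← h1]
    exact Subgroup.zpowers_le.mpr hzc
  rw [centralAut_eq_centerInn_iff_surjective (hG.eq_top_of_sup_center_of_le_commutator hZle)]
  -- Ranks are computed in the image, whose commutativity and exponent `p` are inherited from
  -- `Hom(G, Z)`.
  let R := (secondCenterQuotHom G).range
  let e : SecondCenterQuot G ≃* R := MonoidHom.ofInjective (secondCenterQuotHom_injective G)
  refine surjective_secondCenterHom_of_card_eq ?_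
  rw [Nat.card_congr e.toEquiv, ← IsPGroup.pow_rank_eq_card_of_pow_eq_one (p := p) (A := R) ?_,
    ← Group.rank_congr e, ← hr, hG.pow_rank_eq_card_monoidHom hZ]
  rintro ⟨f, hf⟩
  refine Subtype.ext (MonoidHom.ext fun x => ?_)
  have : f x ^ p = 1 := hZ ▸ pow_card_eq_one'
  exact this

/-- The order bound gives `m ≤ 2`, so `|G/G'| ≤ p² ≤ |G/Z₃|`. As `G' ≤ Z₃`, this forces `G' = Z₃ ≥
Z`, and duality gives `|Hom(G, Z)| = |G/G'| = |Z₂/Z|`. -/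
theorem centralAut_eq_centerInn_of_nilpotencyClass_eq_four {p : ℕ} [Fact p.Prime] {G : Type*}
    [Group G] [Finite G] (hG : Nat.card G = p ^ 7) (hc : Group.nilpotencyClass G = 4)
    (hcyc : IsCyclic (Subgroup.center G)) (hZ : Nat.card (Subgroup.center G) = p ^ 2)
    (e : SecondCenterQuot G ≃* Abelianization G) : centralAut G = centerInn G := by
  have hp : p.Prime := Fact.out
  have hGp := IsPGroup.of_card hG
  have hnil := hGp.isNilpotent
  obtain ⟨m, hm⟩ := hGp.card_secondCenterQuot
  have hm2 := IsPGroup.add_le_of_card_center_eq hG (by omega) hZ hm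
  have hA : (commutator G).index = p ^ m := by
    rw [← card_abelianization, ← Nat.card_congr e.toEquiv, hm]
  have hle : commutator G ≤ Subgroup.upperCentralSeries G 3 := commutator_le_upperCentralSeries
    (Subgroup.upperCentralSeries_eq_top_iff_nilpotencyClass_le.mpr (by omega))
  have h3 : p ^ 2 ≤ (Subgroup.upperCentralSeries G 3).index :=
    hGp.sq_le_index_of_upperCentralSeries (n := 2) (by
      rw [ne_eq, Subgroup.upperCentralSeries_eq_top_iff_nilpotencyClass_le]; omega)
  have hidx : (commutator G).index ≤ (Subgroup.upperCentralSeries G 3).index := by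
    rw [hA]
    exact (Nat.pow_le_pow_right hp.pos (by omega)).trans h3
  have hle' : (Subgroup.upperCentralSeries G 3) ≤ commutator G := by
    refine (Subgroup.eq_of_le_of_card_ge hle ?_).ge
    refine Nat.le_of_mul_le_mul_right ?_ (Nat.pos_of_ne_zero
      (Subgroup.index_ne_zero_of_finite (H := Subgroup.upperCentralSeries G 3)))
    rw [Subgroup.card_mul_index, ← (commutator G).card_mul_index]
    gcongr
  have hZle : Subgroup.center G ≤ commutator G := by
    rw [← Subgroup.upperCentralSeries_one]
    exact (Subgroup.upperCentralSeries_mono G (by norm_num)).trans hle'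
  rw [centralAut_eq_centerInn_iff_surjective (hGp.eq_top_of_sup_center_of_le_commutator hZle)]
  obtain ⟨e'⟩ := nonempty_monoidHom_mulEquiv_abelianization (G := G) (C := Subgroup.center G) (by
    intro a
    rw [← orderOf_dvd_iff_pow_eq_one, hZ]
    refine (orderOf_dvd_natCard a).trans ?_
    rw [card_abelianization, hA]
    exact pow_dvd_pow p (by omega))
  exact surjective_secondCenterHom_of_card_eq (Nat.card_congr (e.trans e'.symm).toEquiv)

/-! ### The equivalence -/

theorem centralAut_eq_centerInn_iff_of_card_eq_pow_seven (p : ℕ) (hp : p.Prime) (G : Type*)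
    [Group G] [Finite G] (hG : Nat.card G = p ^ 7) (hcl : Group.nilpotencyClass G ≠ 2) :
    centralAut G = centerInn G ↔
      (Group.nilpotencyClass G = 3 ∧
        Nonempty (Subgroup.center G ≃* Multiplicative (ZMod p)) ∧
        Group.rank G = Group.rank (SecondCenterQuot G) ∧
        (Group.rank G = 2 ∨ Group.rank G = 3 ∨ Group.rank G = 4)) ∨
      (Group.nilpotencyClass G = 4 ∧
        ((Nonempty (Subgroup.center G ≃* Multiplicative (ZMod p)) ∧
          Group.rank G = Group.rank (SecondCenterQuot G) ∧
          (Group.rank G = 2 ∨ Group.rank G = 3)) ∨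
        (Nonempty (Subgroup.center G ≃* Multiplicative (ZMod (p ^ 2))) ∧
          Nonempty (SecondCenterQuot G ≃* Abelianization G)))) ∨
      (Group.nilpotencyClass G = 5 ∧
        Nonempty (Subgroup.center G ≃* Multiplicative (ZMod p)) ∧
        Group.rank G = Group.rank (SecondCenterQuot G) ∧
        Group.rank G = 2) := by
  have := Fact.mk hp
  have hGp := IsPGroup.of_card hG
  have hnil := hGp.isNilpotent
  constructor
  · intro h
    have hne : Subgroup.center G ≠ ⊤ := fun ht => hGp.centralAut_ne_centerInn_of_center_eq_top
      (by rw [hG]; exact lt_self_pow₀ hp.one_lt (by norm_num)) ht h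
    have hc : 3 ≤ Group.nilpotencyClass G := by
      by_contra! hlt
      apply hne
      rw [← Subgroup.upperCentralSeries_one,
        Subgroup.upperCentralSeries_eq_top_iff_nilpotencyClass_le]
      omega
    have hs := (centralAut_eq_centerInn_iff_surjective
      (hGp.eq_top_of_sup_center_of_centralAut hne h)).mp h
    have e : SecondCenterQuot G ≃* (G →* Subgroup.center G) := MulEquiv.ofBijective
      (secondCenterQuotHom G)
      ⟨secondCenterQuotHom_injective G, (secondCenterQuotHom_surjective_iff G).mpr hs⟩
    obtain ⟨k, hk⟩ := IsPGroup.iff_card.mp (hGp.to_subgroup (Subgroup.center G))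
    obtain ⟨m, hm⟩ := hGp.card_secondCenterQuot
    have hH : Nat.card (G →* Subgroup.center G) = p ^ m := by rw [← Nat.card_congr e.toEquiv, hm]
    have hkm := IsPGroup.add_le_of_card_center_eq hG hc hk hm
    have hr2 := Group.two_le_rank_of_center_ne_top hne
    have hk0 : k ≠ 0 := by
      rintro rfl
      obtain ⟨z, hz, -, ho⟩ := hGp.exists_mem_center_commutator_orderOf_eq hne
      rw [Subgroup.card_eq_one.mp (hk.trans (pow_zero p)), Subgroup.mem_bot] at hz
      rw [hz, orderOf_one] at ho
      exact hp.one_lt.ne ho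
    have hrm : Group.rank G ≤ m := by
      have := hGp.pow_rank_le_card_monoidHom hk hk0
      rwa [hH, Nat.pow_le_pow_iff_right hp.one_lt] at this
    -- Otherwise `k ≥ 2` and `m ≥ 2 * Group.rank G ≥ 4`, against `k + m ≤ 5`.
    have hcyc : IsCyclic (Subgroup.center G) := by
      by_contra hncyc
      have hk2 : k ≠ 1 := by
        rintro rfl
        exact hncyc (isCyclic_of_prime_card (p := p) (by simpa using hk))
      have h1 := IsPGroup.card_monoidHom_sq_le (G := G) (C := Multiplicative (ZMod p)) (by simp)
        (hGp.to_subgroup (Subgroup.center G)) hncyc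
      rw [← hGp.pow_rank_eq_card_monoidHom (by simp), hH, ← pow_mul,
        Nat.pow_le_pow_iff_right hp.one_lt] at h1
      omega
    have hZ : Nonempty (Subgroup.center G ≃* Multiplicative (ZMod (p ^ k))) :=
      ⟨mulEquivOfCyclicCardEq (by simp [hk])⟩
    rcases Nat.lt_or_ge k 2 with hk1 | hk2
    · obtain rfl : k = 1 := by omega
      rw [pow_one] at hZ hk
      have hrm' : Group.rank G = m := by
        have := hGp.pow_rank_eq_card_monoidHom hk
        rw [hH] at this
        exact Nat.pow_right_injective hp.two_le this
      have hrV : Group.rank (SecondCenterQuot G) = m := by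
        rw [Group.rank_congr e]
        have := IsPGroup.pow_rank_eq_card_of_pow_eq_one (p := p) (A := G →* Subgroup.center G)
          (fun f => MonoidHom.ext fun x => by
            rw [MonoidHom.pow_apply, MonoidHom.one_apply]
            exact hk ▸ pow_card_eq_one')
        rw [hH] at this
        exact Nat.pow_right_injective hp.two_le this
      have hr : Group.rank G = Group.rank (SecondCenterQuot G) := hrm'.trans hrV.symm
      obtain hc3 | hc4 | hc5 : Group.nilpotencyClass G = 3 ∨ Group.nilpotencyClass G = 4 ∨
          Group.nilpotencyClass G = 5 := by omega
      · exact Or.inl ⟨hc3, hZ, hr, by omega⟩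
      · exact Or.inr (Or.inl ⟨hc4, Or.inl ⟨hZ, hr, by omega⟩⟩)
      · exact Or.inr (Or.inr ⟨hc5, hZ, hr, by omega⟩)
    · rcases hc.eq_or_lt with hc3 | hc4
      · have := IsPGroup.card_center_eq_prime_of_commutator_le_secondCenter hG hs
          (commutator_le_upperCentralSeries
            (Subgroup.upperCentralSeries_eq_top_iff_nilpotencyClass_le.mpr hc3.ge))
          hcyc hr2 hk hm hH (by omega) (by omega)
        omega
      -- Class at least 4 gives `k + m ≤ 4`, while `k` and `m` are at least 2; so the class is
      -- exactly 4.
      · obtain rfl : k = 2 := by omega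
        obtain rfl : m = 2 := by omega
        have hpow := hGp.monoidHom_pow_eq_one_of_card_eq hk (by norm_num)
          (by rw [hH]; exact Nat.pow_le_pow_right hp.pos hr2)
        obtain ⟨e'⟩ := nonempty_monoidHom_mulEquiv_abelianization (G := G)
          (C := Subgroup.center G) (fun a => by
            rw [hk, sq, pow_mul, hGp.pow_abelianization_eq_one hk le_rfl hpow])
        exact Or.inr (Or.inl ⟨by omega, Or.inr ⟨hZ, ⟨e.trans e'⟩⟩⟩)
  · have key : 3 ≤ Group.nilpotencyClass G →
        Nonempty (Subgroup.center G ≃* Multiplicative (ZMod p)) →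
        Group.rank G = Group.rank (SecondCenterQuot G) → centralAut G = centerInn G := by
      rintro hc ⟨e⟩ hr
      exact centralAut_eq_centerInn_of_rank_eq hGp
        (Group.center_ne_top_of_two_le_nilpotencyClass (by omega))
        (by rw [Nat.card_congr e.toEquiv]; simp) hr
    rintro (⟨hc, hZ, hr, -⟩ | ⟨hc, ⟨hZ, hr, -⟩ | ⟨⟨e⟩, ⟨e'⟩⟩⟩ | ⟨hc, hZ, hr, -⟩)
    · exact key (by omega) hZ hr
    · exact key (by omega) hZ hr
    · exact centralAut_eq_centerInn_of_nilpotencyClass_eq_four hG hc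
        (isCyclic_of_surjective e.symm e.symm.surjective)
        (by rw [Nat.card_congr e.toEquiv]; simp) e'
    · exact key (by omega) hZ hr

end CentralAutomorphisms

theorem theorem3p3 (p : ℕ) (hp : p.Prime) (G : Type*) [Group G] [Finite G]
    (hG : Nat.card G = p ^ 7) (hcl : Group.nilpotencyClass G ≠ 2) :
    centralAut G = centerInn G ↔
      (Group.nilpotencyClass G = 3 ∧
        Nonempty (Subgroup.center G ≃* Multiplicative (ZMod p)) ∧
        Group.rank G = Group.rank (SecondCenterQuot G) ∧
        (Group.rank G = 2 ∨ Group.rank G = 3 ∨ Group.rank G = 4)) ∨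
      (Group.nilpotencyClass G = 4 ∧
        ((Nonempty (Subgroup.center G ≃* Multiplicative (ZMod p)) ∧
          Group.rank G = Group.rank (SecondCenterQuot G) ∧
          (Group.rank G = 2 ∨ Group.rank G = 3)) ∨
        (Nonempty (Subgroup.center G ≃* Multiplicative (ZMod (p ^ 2))) ∧
          Nonempty (SecondCenterQuot G ≃* Abelianization G)))) ∨
      (Group.nilpotencyClass G = 5 ∧
        Nonempty (Subgroup.center G ≃* Multiplicative (ZMod p)) ∧
        Group.rank G = Group.rank (SecondCenterQuot G) ∧
        Group.rank G = 2) :=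
  centralAut_eq_centerInn_iff_of_card_eq_pow_seven p hp G hG hcl
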